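/- Let $\mathcal S$ be the set of all sequences $\alpha=(\alpha_i)_{i\in\mathbb N}$ of real numbers with $1\ge\alpha_1\ge\alpha_2\ge\dots\ge 0$ and $\lim_i\alpha_i=0$. Let $\mathbf R,\mathbf C\subset B(\ell_2)$ be the row and column operator spaces, that is, the closed linear spans of the matrix units $(E_{1j})_{j\in\mathbb N}$ and $(E_{i1})_{i\in\mathbb N}$ respectively, and let $\mathbf R\oplus\mathbf C\subset B(\ell_2\oplus_2\ell_2)$ be their direct sum. For $\alpha\in\mathcal S$, let $X^d(\alpha)\subset\mathbf R\oplus\mathbf C$ be the closed linear span of the vectors $e_i(\alpha)=E_{1i}\oplus\alpha_iE_{i1}$ ($i\in\mathbb N$), called the canonical basis of $X^d(\alpha)$; equivalently, $$X^d(\alpha)=\Big\{\Big(\sum_j x_jE_{1j}\Big)\oplus\Big(\sum_i\alpha_ix_iE_{i1}\Big):x\in\ell_2\Big\}.$$ For a linear map $u:X\to Y$ between operator spaces, $\|u\|_{cb}=\sup_n\|I_{M_n}\otimes u:M_n(X)\to M_n(Y)\|$, where for $X\subset B(H)$ the norm on $M_n(X)$ is that inherited from $B(\ell_2^n\otimes_2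 H)$. **Theorem.** Let $\alpha,\beta\in\mathcal S$ and $C\ge 0$, and suppose that there is an isomorphism $U:X^d(\alpha)\to X^d(\beta)$ with $\|U\|_{cb}\le C$ and $\|U^{-1}\|_{cb}\le C$. Then the formal identity $id:X^d(\alpha)\to X^d(\beta)$, i.e. the bounded linear bijection which maps $e_i(\alpha)$ to $e_i(\beta)$ for every $i\in\mathbb N$, satisfies $\|id\|_{cb}<4C^2$ and $\|id^{-1}\|_{cb}<4C^2$. -/

import Mathlib

open scoped ENNReal NNReal

noncomputable section

namespace OpSp

/-! ### Concrete operator spaces and completely bounded norms -/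

section General

variable {H K : Type*} [NormedAddCommGroup H] [InnerProductSpace ℂ H]
  [NormedAddCommGroup K] [InnerProductSpace ℂ K]

/-- The bounded operator on the Hilbert space `H ⊕₂ ⋯ ⊕₂ H` (`n` summands, i.e. `ℓ₂ⁿ ⊗₂ H`)
given by an `n × n` matrix of bounded operators on `H`:
`(matOp a v) i = ∑ j, a i j (v j)`. -/
def matOp {n : ℕ} (a : Matrix (Fin n) (Fin n) (H →L[ℂ] H)) :
    PiLp 2 (fun _ : Fin n => H) →L[ℂ] PiLp 2 (fun _ : Fin n => H) :=
  ((PiLp.continuousLinearEquiv 2 ℂ (fun _ : Fin n => H)).symm :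
      (Fin n → H) →L[ℂ] PiLp 2 (fun _ : Fin n => H)) ∘L
    ContinuousLinearMap.pi fun i =>
      ∑ j, a i j ∘L (PiLp.proj 2 (fun _ : Fin n => H) j : PiLp 2 (fun _ : Fin n => H) →L[ℂ] H)

theorem matOp_apply {n : ℕ} (a : Matrix (Fin n) (Fin n) (H →L[ℂ] H))
    (v : PiLp 2 (fun _ : Fin n => H)) (i : Fin n) :
    matOp a v i = ∑ j, a i j (v j) := by
  simp [matOp]

/-- The norm of `M_n(X)`, for a space `X` of operators on `H`: the norm of `x ∈ M_n(X)` as an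
operator on `ℓ₂ⁿ ⊗₂ H`. -/
def matNorm (X : Submodule ℂ (H →L[ℂ] H)) {n : ℕ} (x : Matrix (Fin n) (Fin n) X) : ℝ :=
  ‖matOp (x.map (fun y : X => (y : H →L[ℂ] H)))‖

/-- The completely bounded norm `sup_n ‖I_{M_n} ⊗ u : M_n(X) → M_n(Y)‖` of a linear map between
operator spaces `X ⊆ B(H)` and `Y ⊆ B(K)`, with value `∞` if `u` is not completely bounded. -/
def cbNorm {X : Submodule ℂ (H →L[ℂ] H)} {Y : Submodule ℂ (K →L[ℂ] K)} (u : X →ₗ[ℂ] Y) : ℝ≥0∞ :=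
  ⨆ (n : ℕ) (x : Matrix (Fin n) (Fin n) X) (_ : matNorm X x ≤ 1),
    ENNReal.ofReal (matNorm Y (x.map u))

/-- The operator `S ⊕ T` on `H ⊕₂ K`. -/
def dirSum (S : H →L[ℂ] H) (T : K →L[ℂ] K) : WithLp 2 (H × K) →L[ℂ] WithLp 2 (H × K) :=
  ((WithLp.prodContinuousLinearEquiv 2 ℂ H K).symm : H × K →L[ℂ] WithLp 2 (H × K)) ∘L
    (S.prodMap T) ∘L (WithLp.prodContinuousLinearEquiv 2 ℂ H K : WithLp 2 (H × K) →L[ℂ] H × K)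

theorem dirSum_apply (S : H →L[ℂ] H) (T : K →L[ℂ] K) (v : WithLp 2 (H × K)) :
    dirSum S T v = WithLp.toLp 2 (S v.fst, T v.snd) := rfl

theorem norm_le_norm_dirSum (S : H →L[ℂ] H) (T : K →L[ℂ] K) : ‖S‖ ≤ ‖dirSum S T‖ := by
  refine S.opNorm_le_bound (norm_nonneg (dirSum S T)) fun h => ?_
  have := (dirSum S T).le_opNorm (WithLp.toLp 2 (h, 0))
  simpa [dirSum_apply] using this

theorem norm_dirSum_le (S : H →L[ℂ] H) (T : K →L[ℂ] K) : ‖dirSum S T‖ ≤ ‖S‖ + ‖T‖ := by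
  refine (dirSum S T).opNorm_le_bound (add_nonneg (norm_nonneg S) (norm_nonneg T)) fun v => ?_
  have h : dirSum S T v = WithLp.toLp 2 (S v.fst, 0) + WithLp.toLp 2 (0, T v.snd) := by
    rw [dirSum_apply, ← WithLp.toLp_add, Prod.mk_add_mk, add_zero, zero_add]
  have h₁ : ‖v.fst‖ ≤ ‖v‖ := WithLp.norm_fst_le _ v
  have h₂ : ‖v.snd‖ ≤ ‖v‖ := WithLp.norm_snd_le _ v
  rw [h, add_mul]
  refine (norm_add_le _ _).trans (add_le_add ?_ ?_)
  · rw [WithLp.norm_toLp_fst]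
    exact (S.le_opNorm _).trans (by gcongr)
  · rw [WithLp.norm_toLp_snd]
    exact (T.le_opNorm _).trans (by gcongr)

end General

/-! ### The spaces `X(A)` and `X^d(α)` -/

/-- The complex Hilbert space `ℓ₂`. -/
abbrev L2 : Type := lp (fun _ : ℕ => ℂ) 2

/-- The canonical orthonormal basis `ξ_i` of `ℓ₂`. -/
def xi (i : ℕ) : L2 := lp.single 2 i 1

theorem norm_xi (i : ℕ) : ‖xi i‖ = 1 := by
  simp [xi, lp.norm_single]

/-- The element `∑ j, x_j E_{0j}` of the row space `R = span {E_{0j}} ⊆ B(ℓ₂)`, where `E_{ij}` are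
the matrix units: the operator `ζ ↦ (∑ j, x_j ζ_j) ξ_0`. It is linear in `x`. -/
def rowOp (x : L2) : L2 →L[ℂ] L2 := InnerProductSpace.rankOne ℂ (xi 0) (star x)

/-- The element `∑ i, y_i E_{i0}` of the column space `C = span {E_{i0}} ⊆ B(ℓ₂)`: the operator
`ζ ↦ ζ_0 y`. -/
def colOp (y : L2) : L2 →L[ℂ] L2 := InnerProductSpace.rankOne ℂ y (xi 0)

/-- The map `x ↦ (x, A x) ∈ R ⊕ C ⊆ B(ℓ₂ ⊕₂ ℓ₂)`. -/
def embed (A : L2 →L[ℂ] L2) : L2 →ₗ[ℂ] (WithLp 2 (L2 × L2) →L[ℂ] WithLp 2 (L2 × L2)) where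
  toFun x := dirSum (rowOp x) (colOp (A x))
  map_add' x y := by
    ext v : 1
    simp only [dirSum_apply, rowOp, colOp, InnerProductSpace.rankOne_apply, star_add, map_add, add_apply]
    rw [← WithLp.toLp_add, Prod.mk_add_mk]
  map_smul' c x := by
    ext v : 1
    simp only [dirSum_apply, rowOp, colOp, InnerProductSpace.rankOne_apply, star_smul, map_smul,
      inner_smul_left, RingHom.id_apply, smul_apply]
    rw [← WithLp.toLp_smul, Prod.smul_mk, smul_smul]
    simp [smul_smul]

theorem norm_le_norm_embed (A : L2 →L[ℂ] L2) (x : L2) : ‖x‖ ≤ ‖embed A x‖ := by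
  refine le_trans (le_of_eq ?_) (norm_le_norm_dirSum (rowOp x) (colOp (A x)))
  simp [rowOp, norm_xi]

theorem embed_injective (A : L2 →L[ℂ] L2) : Function.Injective (embed A) := by
  rw [injective_iff_map_eq_zero]
  intro x hx
  have := norm_le_norm_embed A x
  rw [hx, norm_zero] at this
  exact norm_le_zero_iff.mp this

/-- The operator space `X(A) = {(x, A x) : x ∈ ℓ₂} ⊆ R ⊕ C ⊆ B(ℓ₂ ⊕₂ ℓ₂)`. -/
def XA (A : L2 →L[ℂ] L2) : Submodule ℂ (WithLp 2 (L2 × L2) →L[ℂ] WithLp 2 (L2 × L2)) :=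
  LinearMap.range (embed A)

theorem isClosed_XA (A : L2 →L[ℂ] L2) :
    IsClosed (XA A : Set (WithLp 2 (L2 × L2) →L[ℂ] WithLp 2 (L2 × L2))) := by
  have hb : ∀ x, ‖embed A x‖ ≤ (1 + ‖A‖) * ‖x‖ := fun x => by
    refine (norm_dirSum_le (rowOp x) (colOp (A x))).trans ?_
    have := A.le_opNorm x
    simp only [rowOp, colOp, InnerProductSpace.norm_rankOne, norm_xi, norm_star]
    linarith
  have hu : UniformContinuous (embed A) :=
    ((embed A).mkContinuous _ hb).uniformContinuous
  have ha : AntilipschitzWith 1 (embed A) :=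
    AddMonoidHomClass.antilipschitz_of_bound (embed A) fun x => by
      simpa using norm_le_norm_embed A x
  rw [XA, LinearMap.coe_range]
  exact ha.isClosed_range hu

/-- The linear bijection `x ↦ (x, A x)` from `ℓ₂` onto `X(A)`. -/
def toX (A : L2 →L[ℂ] L2) : L2 ≃ₗ[ℂ] XA A := LinearEquiv.ofInjective (embed A) (embed_injective A)

theorem memℓp_diag (α : ℕ → unitInterval) (x : L2) :
    Memℓp (fun i => ((α i : ℝ) : ℂ) * x i) 2 := by
  refine (lp.memℓp x).mono' fun i => ?_
  rw [norm_mul, Complex.norm_real, Real.norm_of_nonneg (α i).2.1]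
  exact mul_le_of_le_one_left (norm_nonneg _) (α i).2.2

/-- The diagonal operator `diag(α)` on `ℓ₂`, for a sequence `α` in `[0, 1]`. -/
def diag (α : ℕ → unitInterval) : L2 →L[ℂ] L2 :=
  LinearMap.mkContinuous
    { toFun := fun x => ⟨fun i => ((α i : ℝ) : ℂ) * x i, memℓp_diag α x⟩
      map_add' := fun x y => lp.ext (funext fun i => mul_add _ (x i) (y i))
      map_smul' := fun c x => lp.ext (funext fun i => mul_left_comm _ c (x i)) }
    1 (fun x => by
      rw [one_mul]
      refine lp.norm_mono two_ne_zero fun i => ?_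
      change ‖((α i : ℝ) : ℂ) * x i‖ ≤ _
      rw [norm_mul, Complex.norm_real, Real.norm_of_nonneg (α i).2.1]
      exact mul_le_of_le_one_left (norm_nonneg _) (α i).2.2)

theorem diag_apply (α : ℕ → unitInterval) (x : L2) (i : ℕ) :
    diag α x i = ((α i : ℝ) : ℂ) * x i := rfl

/-- The operator space `X^d(α) = X(diag(α))`. -/
abbrev Xd (α : ℕ → unitInterval) :
    Submodule ℂ (WithLp 2 (L2 × L2) →L[ℂ] WithLp 2 (L2 × L2)) :=
  XA (diag α)

/-- The canonical basis `e_i(α) = ξ_i ⊕ α_i ξ_i` of `X^d(α)`. -/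
def basisVec (α : ℕ → unitInterval) (i : ℕ) : Xd α := toX (diag α) (xi i)

theorem coe_basisVec (α : ℕ → unitInterval) (i : ℕ) :
    (basisVec α i : WithLp 2 (L2 × L2) →L[ℂ] WithLp 2 (L2 × L2)) =
      dirSum (rowOp (xi i)) (colOp (((α i : ℝ) : ℂ) • xi i)) := by
  have h : diag α (xi i) = ((α i : ℝ) : ℂ) • xi i := by
    refine lp.ext (funext fun j => ?_)
    rw [diag_apply]
    rcases eq_or_ne j i with rfl | hj
    · rfl
    · rw [lp.coeFn_smul, Pi.smul_apply, xi, lp.single_apply_ne _ _ _ hj]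
      simp
  rw [← h]
  rfl

/-- The formal identity `X^d(α) → X^d(β)`, that is
`(x, diag(α) x) ↦ (x, diag(β) x)` for `x ∈ ℓ₂`. -/
def formalId (α β : ℕ → unitInterval) : Xd α ≃ₗ[ℂ] Xd β :=
  (toX (diag α)).symm.trans (toX (diag β))

theorem formalId_basisVec (α β : ℕ → unitInterval) (i : ℕ) :
    formalId α β (basisVec α i) = basisVec β i := by
  simp [formalId, basisVec]

/-- The set `𝒮` of non-increasing sequences in `[0, 1]` which converge to `0`. -/
def seqS : Set (ℕ → unitInterval) :=
  {α | Antitone α ∧ Filter.Tendsto α Filter.atTop (nhds 0)}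

end OpSp

end

open OpSp

open scoped ENNReal NNReal

namespace OpSp

/-! ### Variational bounds for eigenvalues of symmetric operators in finite dimension. -/

section MinMax

open Module LinearMap

variable {E : Type*} [NormedAddCommGroup E] [InnerProductSpace ℂ E] {n : ℕ}

/-! Identify the spaces with `ℓ₂` through the first component, and let `R` be the operator
representing `U⁻¹`, so `‖R‖ ≤ C`. A matrix over `X(A)` has norm the maximum of a row part,
independent of `A`, and a column part, where `A` enters. For orthonormal `w_i`, the column with
entries `R w_i` has row part at most `C` by Bessel and column part the root of `∑ ‖A R w_i‖²`.
Applying `U` gives `∑ ‖B w_i‖² ≤ C² (C² + ∑ ‖A R w_i‖²)` (`sum_norm_sq_le_of_orthonormal`).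

For `A = diag α`, `B = diag β`, compressed to the first `n` coordinates, this says that all partial
traces of `P - Q` are at most `C⁴`, where `P` comes from `B*B` and `Q` from `C² R*A*A R`. Hence the
sorted eigenvalues satisfy `∑ (λ_k(P) - λ_k(Q))₊ ≤ C⁴` (`sum_max_eigenvalues_sub_le`). Since `λ_k(P)
≥ β_k²` and `λ_k(Q) ≤ (C² α_k)²`, it follows that `∑ (β_k² - (C² α_k)²)₊ ≤ C⁴`
(`sum_max_sq_sub_le`).

Conversely, with `K = C²`, such a bound controls the formal identity: `β_k²` is at most `K² α_k²`,
absorbed by the column part in `X^d(α)`, plus a remainder of sum at most `K²`, absorbed by the row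
part (`cbNorm_formalId_le`). The inverse follows by symmetry. -/

theorem inner_eq_zero_of_mem_span (u : OrthonormalBasis (Fin n) ℂ E) {p : Fin n → Prop} {x : E}
    (hx : x ∈ Submodule.span ℂ (Set.range fun i : {i // p i} => u i)) {j : Fin n} (hj : ¬ p j) :
    inner ℂ (u j) x = 0 := by
  induction hx using Submodule.span_induction with
  | mem x h =>
    obtain ⟨⟨i, hi⟩, rfl⟩ := h
    exact u.orthonormal.2 fun h => hj (h ▸ hi)
  | zero => simp
  | add x y _ _ hx hy => rw [inner_add_right, hx, hy, add_zero]
  | smul a x _ hx => rw [inner_smul_right, hx, mul_zero]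

theorem finrank_span_subfamily (u : OrthonormalBasis (Fin n) ℂ E) (p : Fin n → Prop)
    [DecidablePred p] :
    finrank ℂ (Submodule.span ℂ (Set.range fun i : {i // p i} => u i)) =
      Fintype.card {i // p i} :=
  finrank_span_eq_card (u.orthonormal.linearIndependent.comp _ Subtype.val_injective)

variable [FiniteDimensional ℂ E] (hn : finrank ℂ E = n)

theorem exists_ne_zero_mem_inf {S W : Submodule ℂ E}
    (h : finrank ℂ E < finrank ℂ S + finrank ℂ W) : ∃ x ∈ S, x ∈ W ∧ x ≠ 0 := by
  have h₁ := Submodule.finrank_sup_add_finrank_inf_eq S W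
  have h₂ := Submodule.finrank_le (S ⊔ W)
  have h₃ : S ⊓ W ≠ ⊥ := fun h₀ => by
    rw [h₀, finrank_bot] at h₁
    omega
  obtain ⟨x, hx, hx₀⟩ := (Submodule.ne_bot_iff _).1 h₃
  exact ⟨x, hx.1, hx.2, hx₀⟩

variable {T P Q : E →ₗ[ℂ] E} (hT : T.IsSymmetric) (hP : P.IsSymmetric) (hQ : Q.IsSymmetric)

theorem re_inner_apply_self_eq_sum (x : E) :
    (inner ℂ x (T x)).re =
      ∑ j, hT.eigenvalues hn j * ‖inner ℂ (hT.eigenvectorBasis hn j) x‖ ^ 2 := by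
  rw [← (hT.eigenvectorBasis hn).sum_inner_mul_inner x (T x), Complex.re_sum]
  refine Finset.sum_congr rfl fun j _ => ?_
  rw [← hT, hT.apply_eigenvectorBasis, inner_smul_left, ← inner_conj_symm x, mul_left_comm,
    Complex.conj_mul', RCLike.conj_ofReal, ← Complex.ofReal_pow]
  exact Complex.re_ofReal_mul _ _

theorem re_inner_apply_self_le_of_mem_span {p : Fin n → Prop} {c : ℝ}
    (hc : ∀ j, p j → hT.eigenvalues hn j ≤ c) {x : E}
    (hx : x ∈ Submodule.span ℂ (Set.range fun i : {i // p i} => hT.eigenvectorBasis hn i)) :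
    (inner ℂ x (T x)).re ≤ c * ‖x‖ ^ 2 := by
  rw [re_inner_apply_self_eq_sum hn hT, ← (hT.eigenvectorBasis hn).sum_sq_norm_inner_right x,
    Finset.mul_sum]
  refine Finset.sum_le_sum fun j _ => ?_
  by_cases hj : p j
  · exact mul_le_mul_of_nonneg_right (hc j hj) (by positivity)
  · simp [inner_eq_zero_of_mem_span _ hx hj]

theorem le_re_inner_apply_self_of_mem_span {p : Fin n → Prop} {c : ℝ}
    (hc : ∀ j, p j → c ≤ hT.eigenvalues hn j) {x : E}
    (hx : x ∈ Submodule.span ℂ (Set.range fun i : {i // p i} => hT.eigenvectorBasis hn i)) :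
    c * ‖x‖ ^ 2 ≤ (inner ℂ x (T x)).re := by
  rw [re_inner_apply_self_eq_sum hn hT, ← (hT.eigenvectorBasis hn).sum_sq_norm_inner_right x,
    Finset.mul_sum]
  refine Finset.sum_le_sum fun j _ => ?_
  by_cases hj : p j
  · exact mul_le_mul_of_nonneg_right (hc j hj) (by positivity)
  · simp [inner_eq_zero_of_mem_span _ hx hj]

/-- The lower half of the Courant–Fischer principle. -/
theorem le_eigenvalues_of_subspace (i : Fin n) (S : Submodule ℂ E) (hS : (i : ℕ) < finrank ℂ S)
    {c : ℝ} (hc : ∀ x ∈ S, c * ‖x‖ ^ 2 ≤ (inner ℂ x (T x)).re) : c ≤ hT.eigenvalues hn i := by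
  obtain ⟨x, hx, hxW, hx₀⟩ := exists_ne_zero_mem_inf (S := S) (W := Submodule.span ℂ
    (Set.range fun j : {j // i ≤ j} => hT.eigenvectorBasis hn j)) (by
      rw [finrank_span_subfamily, Fintype.card_subtype, Finset.filter_le_eq_Ici, Fin.card_Ici]
      omega)
  refine le_of_mul_le_mul_right ((hc x hx).trans
    (re_inner_apply_self_le_of_mem_span hn hT (fun j hj => ?_) hxW)) (by positivity)
  exact hT.eigenvalues_antitone hn hj

/-- The upper half of the Courant–Fischer principle. -/
theorem eigenvalues_le_of_subspace (i : Fin n) (S : Submodule ℂ E) (hS : n ≤ finrank ℂ S + i)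
    {c : ℝ} (hc : ∀ x ∈ S, (inner ℂ x (T x)).re ≤ c * ‖x‖ ^ 2) : hT.eigenvalues hn i ≤ c := by
  obtain ⟨x, hx, hxW, hx₀⟩ := exists_ne_zero_mem_inf (S := S) (W := Submodule.span ℂ
    (Set.range fun j : {j // j ≤ i} => hT.eigenvectorBasis hn j)) (by
      rw [finrank_span_subfamily, Fintype.card_subtype, Finset.filter_ge_eq_Iic, Fin.card_Iic]
      omega)
  refine le_of_mul_le_mul_right ((le_re_inner_apply_self_of_mem_span hn hT (fun j hj => ?_)
    hxW).trans (hc x hx)) (by positivity)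
  exact hT.eigenvalues_antitone hn hj

/-- Weyl's monotonicity principle. -/
theorem eigenvalues_mono (h : ∀ x, (inner ℂ x (P x)).re ≤ (inner ℂ x (Q x)).re) (i : Fin n) :
    hP.eigenvalues hn i ≤ hQ.eigenvalues hn i := by
  refine le_eigenvalues_of_subspace hn hQ i (Submodule.span ℂ
    (Set.range fun j : {j // j ≤ i} => hP.eigenvectorBasis hn j)) ?_ fun x hx =>
    (le_re_inner_apply_self_of_mem_span hn hP (fun j hj => hP.eigenvalues_antitone hn hj)
      hx).trans (h x)
  rw [finrank_span_subfamily, Fintype.card_subtype, Finset.filter_ge_eq_Iic, Fin.card_Iic]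
  omega

/-- If all partial traces of `P - Q` are at most `K`, then the sorted eigenvalues of `P` exceed
those of `Q` by at most `K` in total. -/
theorem sum_max_eigenvalues_sub_le {K : ℝ}
    (h : ∀ (u : OrthonormalBasis (Fin n) ℂ E) (s : Finset (Fin n)),
      ∑ i ∈ s, (inner ℂ (u i) ((P - Q) (u i))).re ≤ K) :
    ∑ i, max (hP.eigenvalues hn i - hQ.eigenvalues hn i) 0 ≤ K := by
  have hH : (P - Q).IsSymmetric := hP.sub hQ
  set u := hH.eigenvectorBasis hn with hu
  set μ := hH.eigenvalues hn with hμ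
  -- `D` is the positive part of `P - Q`. Both `P` and `Q` lie below `Q + D`, so each `(λ_i(P) -
  -- λ_i(Q))₊` is at most `λ_i(Q + D) - λ_i(Q)`, and these differences sum to the trace of `D`.
  let D : E →ₗ[ℂ] E := ∑ i, ((max (μ i) 0 : ℝ) : ℂ) •
    (InnerProductSpace.rankOne ℂ (u i) (u i) : E →ₗ[ℂ] E)
  have hDx : ∀ x y, inner ℂ x (D y) =
      ∑ i, ((max (μ i) 0 : ℝ) : ℂ) * (inner ℂ (u i) y * inner ℂ x (u i)) := fun x y => by
    simp [D, LinearMap.sum_apply]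
  have hD : D.IsSymmetric := fun x y => by
    rw [← inner_conj_symm, hDx, hDx, map_sum]
    refine Finset.sum_congr rfl fun i _ => ?_
    rw [map_mul, map_mul, Complex.conj_ofReal, inner_conj_symm, inner_conj_symm]
    ring
  have hDre : ∀ x, (inner ℂ x (D x)).re = ∑ i, max (μ i) 0 * ‖inner ℂ (u i) x‖ ^ 2 := fun x => by
    rw [hDx, Complex.re_sum]
    refine Finset.sum_congr rfl fun i _ => ?_
    rw [← inner_conj_symm x, Complex.mul_conj']
    norm_cast
  have hB : (Q + D).IsSymmetric := hQ.add hD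
  have h₁ : ∀ i, hQ.eigenvalues hn i ≤ hB.eigenvalues hn i := eigenvalues_mono hn hQ hB fun x => by
    rw [LinearMap.add_apply, inner_add_right, Complex.add_re, hDre]
    exact le_add_of_nonneg_right (Finset.sum_nonneg fun i _ => by positivity)
  have h₂ : ∀ i, hP.eigenvalues hn i ≤ hB.eigenvalues hn i := eigenvalues_mono hn hP hB fun x => by
    have hx := re_inner_apply_self_eq_sum hn hH x
    rw [LinearMap.sub_apply, inner_sub_right, Complex.sub_re] at hx
    rw [LinearMap.add_apply, inner_add_right, Complex.add_re, hDre, ← sub_le_iff_le_add', hx]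
    exact Finset.sum_le_sum fun i _ => mul_le_mul_of_nonneg_right (le_max_left _ _) (by positivity)
  have htr : ∑ i, (hB.eigenvalues hn i - hQ.eigenvalues hn i) = ∑ i, max (μ i) 0 := by
    rw [Finset.sum_sub_distrib, ← hB.re_trace_eq_sum_eigenvalues hn,
      ← hQ.re_trace_eq_sum_eigenvalues hn, map_add, map_add, add_sub_cancel_left, map_sum, map_sum]
    refine Finset.sum_congr rfl fun i _ => ?_
    rw [map_smul, InnerProductSpace.trace_rankOne, inner_self_eq_norm_sq_to_K,
      u.orthonormal.1 i]
    simp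
  have hK : ∑ i, max (μ i) 0 ≤ K := by
    -- The trace of `D` is itself a partial trace of `P - Q`, over the eigenvectors with positive
    -- eigenvalue.
    refine le_trans (le_of_eq ?_) (h u {i | 0 < μ i})
    rw [Finset.sum_filter]
    refine Finset.sum_congr rfl fun i _ => ?_
    rw [hu, hH.apply_eigenvectorBasis, inner_smul_right, ← hu, ← hμ, inner_self_eq_norm_sq_to_K,
      u.orthonormal.1 i]
    split_ifs with hi
    · simp [hi.le]
    · simp [not_lt.1 hi]
  refine le_trans (Finset.sum_le_sum fun i _ => ?_) (htr.trans_le hK)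
  exact max_le (sub_le_sub_right (h₂ i) _) (sub_nonneg.2 (h₁ i))

end MinMax

/-! ### Matrix norms over `X(A)`. -/

section MatNorm

variable {n : ℕ}

theorem inner_xi_left (i : ℕ) (z : L2) : inner ℂ (xi i) z = z i := by
  simp [xi, lp.inner_single_left]

theorem xi_apply (i j : ℕ) : xi i j = if j = i then 1 else 0 := by
  simp [xi, lp.single_apply, Pi.single_apply]

/-- The matrix over `X(A)` with entries `(x, A x)`, where `x` runs through the entries of `V`. -/
noncomputable def matX (A : L2 →L[ℂ] L2) (V : Matrix (Fin n) (Fin n) L2) :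
    Matrix (Fin n) (Fin n) (XA A) :=
  V.map (toX A)

theorem matX_symm (A : L2 →L[ℂ] L2) (x : Matrix (Fin n) (Fin n) (XA A)) :
    matX A (x.map (toX A).symm) = x := by
  ext i j : 2
  simp [matX]

theorem norm_sq_toLp_prod (a b : L2) : ‖WithLp.toLp 2 (a, b)‖ ^ 2 = ‖a‖ ^ 2 + ‖b‖ ^ 2 :=
  WithLp.prod_norm_sq_eq_of_L2 _

theorem norm_sq_matOp_matX (A : L2 →L[ℂ] L2) (V : Matrix (Fin n) (Fin n) L2)
    (v : PiLp 2 (fun _ : Fin n => WithLp 2 (L2 × L2))) :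
    ‖matOp ((matX A V).map (fun y : XA A => (y : WithLp 2 (L2 × L2) →L[ℂ] WithLp 2 (L2 × L2)))) v‖
        ^ 2 = ∑ i, ‖∑ j, inner ℂ (star (V i j)) (v j).fst‖ ^ 2 +
      ∑ i, ‖A (∑ j, (v j).snd 0 • V i j)‖ ^ 2 := by
  rw [PiLp.norm_sq_eq_of_L2, ← Finset.sum_add_distrib]
  refine Finset.sum_congr rfl fun i _ => ?_
  have h : ∀ j, (toX A (V i j) : WithLp 2 (L2 × L2) →L[ℂ] WithLp 2 (L2 × L2)) (v j) =
      WithLp.toLp 2 (inner ℂ (star (V i j)) (v j).fst • xi 0, A ((v j).snd 0 • V i j)) :=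
    fun j => by
      change dirSum (rowOp (V i j)) (colOp (A (V i j))) (v j) = _
      rw [dirSum_apply, rowOp, colOp, InnerProductSpace.rankOne_apply,
        InnerProductSpace.rankOne_apply, inner_xi_left, map_smul]
  rw [matOp_apply]
  simp only [matX, Matrix.map_apply, h]
  rw [← WithLp.toLp_sum, ← prod_mk_sum, norm_sq_toLp_prod, ← Finset.sum_smul, norm_smul,
    norm_xi, mul_one, map_sum]

/-- The row part acts only on the first components and the column part only on the second, with
orthogonal outputs, so the norm is the maximum of the two. The column part sees only coordinate `0`
of its input, hence scalars `q`. -/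
theorem matNorm_matX_le_iff (A : L2 →L[ℂ] L2) (V : Matrix (Fin n) (Fin n) L2) {M : ℝ}
    (hM : 0 ≤ M) :
    matNorm (XA A) (matX A V) ≤ M ↔
      (∀ p : Fin n → L2, ∑ i, ‖∑ j, inner ℂ (star (V i j)) (p j)‖ ^ 2 ≤ M ^ 2 * ∑ j, ‖p j‖ ^ 2) ∧
      ∀ q : Fin n → ℂ, ∑ i, ‖A (∑ j, q j • V i j)‖ ^ 2 ≤ M ^ 2 * ∑ j, ‖q j‖ ^ 2 := by
  have key : ∀ v : PiLp 2 (fun _ : Fin n => WithLp 2 (L2 × L2)),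
      ‖v‖ ^ 2 = ∑ j, ‖(v j).fst‖ ^ 2 + ∑ j, ‖(v j).snd‖ ^ 2 := fun v => by
    rw [PiLp.norm_sq_eq_of_L2, ← Finset.sum_add_distrib]
    exact Finset.sum_congr rfl fun j _ => WithLp.prod_norm_sq_eq_of_L2 _
  constructor
  · intro h
    have h' := fun v : PiLp 2 (fun _ : Fin n => WithLp 2 (L2 × L2)) =>
      pow_le_pow_left₀ (norm_nonneg _) (ContinuousLinearMap.le_of_opNorm_le _ h v) 2
    constructor
    · intro p
      have := h' (WithLp.toLp 2 fun j => WithLp.toLp 2 (p j, 0))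
      rw [norm_sq_matOp_matX, mul_pow, key] at this
      simpa using this
    · intro q
      have := h' (WithLp.toLp 2 fun j => WithLp.toLp 2 (0, q j • xi 0))
      rw [norm_sq_matOp_matX, mul_pow, key] at this
      simpa [norm_smul, norm_xi, xi_apply] using this
  · rintro ⟨hr, hc⟩
    refine ContinuousLinearMap.opNorm_le_bound _ hM fun v => ?_
    refine le_of_sq_le_sq ?_ (by positivity)
    rw [norm_sq_matOp_matX, mul_pow, key, mul_add]
    refine add_le_add (hr _) ((hc _).trans ?_)
    gcongr with j
    exact lp.norm_apply_le_norm two_ne_zero _ 0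

theorem matOp_smul {H : Type*} [NormedAddCommGroup H] [InnerProductSpace ℂ H]
    (c : ℂ) (a : Matrix (Fin n) (Fin n) (H →L[ℂ] H)) : matOp (c • a) = c • matOp a := by
  ext v i
  simp [matOp_apply, Finset.smul_sum]

theorem matNorm_smul_le {H : Type*} [NormedAddCommGroup H] [InnerProductSpace ℂ H]
    (X : Submodule ℂ (H →L[ℂ] H)) (c : ℂ) (x : Matrix (Fin n) (Fin n) X) :
    matNorm X (c • x) ≤ ‖c‖ * matNorm X x := by
  change ‖matOp (c • x.map (fun y : X => (y : H →L[ℂ] H)))‖ ≤ _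
  rw [matOp_smul]
  exact ContinuousLinearMap.opNorm_smul_le c _

theorem matNorm_map_le_of_cbNorm_le {H K : Type*} [NormedAddCommGroup H] [InnerProductSpace ℂ H]
    [NormedAddCommGroup K] [InnerProductSpace ℂ K] {X : Submodule ℂ (H →L[ℂ] H)}
    {Y : Submodule ℂ (K →L[ℂ] K)} {u : X →ₗ[ℂ] Y} {C : ℝ≥0} (h : cbNorm u ≤ C)
    (x : Matrix (Fin n) (Fin n) X) {M : ℝ} (hM : 0 < M) (hx : matNorm X x ≤ M) :
    matNorm Y (x.map u) ≤ C * M := by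
  have hn : ∀ r : ℝ, 0 ≤ r → ‖(r : ℂ)‖ = r := fun r hr => by
    rw [Complex.norm_real, Real.norm_of_nonneg hr]
  set y : Matrix (Fin n) (Fin n) X := ((M⁻¹ : ℝ) : ℂ) • x with hy
  have h₁ : matNorm X y ≤ 1 := by
    refine (matNorm_smul_le _ _ _).trans ?_
    rwa [hn _ (by positivity), inv_mul_le_iff₀ hM, mul_one]
  have h₂ : ENNReal.ofReal (matNorm Y (y.map u)) ≤ C :=
    (le_iSup_of_le (f := fun n => ⨆ (x : Matrix (Fin n) (Fin n) X) (_ : matNorm X x ≤ 1),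
      ENNReal.ofReal (matNorm Y (x.map u))) n (le_iSup₂_of_le y h₁ le_rfl)).trans h
  have h₃ : x.map u = (M : ℂ) • y.map u := by
    ext i j : 2
    simp [hy, smul_smul, hM.ne']
  rw [← ENNReal.ofReal_coe_nnreal, ENNReal.ofReal_le_ofReal_iff C.coe_nonneg] at h₂
  rw [h₃, mul_comm]
  refine (matNorm_smul_le _ _ _).trans ?_
  rw [hn _ hM.le]
  exact mul_le_mul_of_nonneg_left h₂ hM.le

theorem cbNorm_le_of_matNorm_le {H K : Type*} [NormedAddCommGroup H] [InnerProductSpace ℂ H]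
    [NormedAddCommGroup K] [InnerProductSpace ℂ K] {X : Submodule ℂ (H →L[ℂ] H)}
    {Y : Submodule ℂ (K →L[ℂ] K)} {u : X →ₗ[ℂ] Y} {C : ℝ}
    (h : ∀ (n : ℕ) (x : Matrix (Fin n) (Fin n) X), matNorm X x ≤ 1 → matNorm Y (x.map u) ≤ C) :
    cbNorm u ≤ ENNReal.ofReal C :=
  iSup_le fun n => iSup₂_le fun x hx => ENNReal.ofReal_le_ofReal (h n x hx)

end MatNorm

/-! ### Consequences of complete boundedness for the representing maps on `ℓ₂`. -/

section CbMaps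

theorem inner_star_comm (a b : L2) : inner ℂ (star a) b = inner ℂ (star b) a := by
  rw [lp.inner_eq_tsum, lp.inner_eq_tsum]
  refine tsum_congr fun i => ?_
  simp [mul_comm]

/-- The linear map of `ℓ₂` which represents a linear map `X(A) → X(B)`. -/
noncomputable def coordMap {A B : L2 →L[ℂ] L2} (u : XA A →ₗ[ℂ] XA B) : L2 →ₗ[ℂ] L2 :=
  (toX B).symm.toLinearMap ∘ₗ u ∘ₗ (toX A).toLinearMap

theorem matX_map {A B : L2 →L[ℂ] L2} (u : XA A →ₗ[ℂ] XA B) {n : ℕ}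
    (V : Matrix (Fin n) (Fin n) L2) : (matX A V).map u = matX B (V.map (coordMap u)) := by
  ext i j : 2
  simp [matX, coordMap]

theorem coordMap_comp_symm {A B : L2 →L[ℂ] L2} (U : XA A ≃ₗ[ℂ] XA B) (x : L2) :
    coordMap (U : XA A →ₗ[ℂ] XA B) (coordMap (U.symm : XA B →ₗ[ℂ] XA A) x) = x := by
  simp [coordMap]

variable {A B : L2 →L[ℂ] L2} {u : XA A →ₗ[ℂ] XA B} {C : ℝ≥0}

theorem norm_coordMap_le (hA : ‖A‖ ≤ 1) (hu : cbNorm u ≤ C) (x : L2) :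
    ‖coordMap u x‖ ≤ C * ‖x‖ := by
  rcases eq_or_ne x 0 with rfl | hx
  · simp
  have hx₀ : 0 < ‖x‖ := norm_pos_iff.2 hx
  have h₁ : matNorm (XA A) (matX A (Matrix.of fun _ _ : Fin 1 => x)) ≤ ‖x‖ := by
    rw [matNorm_matX_le_iff _ _ (norm_nonneg x)]
    constructor
    · intro p
      simp only [Finset.univ_unique, Finset.sum_singleton, Matrix.of_apply]
      rw [← mul_pow]
      gcongr
      refine (norm_inner_le_norm _ _).trans ?_
      rw [norm_star]
    · intro q
      simp only [Finset.univ_unique, Finset.sum_singleton, Matrix.of_apply]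
      rw [← mul_pow, map_smul, norm_smul, mul_comm]
      gcongr
      exact A.le_of_opNorm_le hA x |>.trans (one_mul _).le
  have h₂ := matNorm_map_le_of_cbNorm_le hu _ hx₀ h₁
  rw [matX_map, matNorm_matX_le_iff _ _ (by positivity)] at h₂
  -- The row functional is tested at the vector where it attains its norm, which yields `‖u x‖⁴ ≤ (C
  -- ‖x‖)² ‖u x‖²`.
  have h₃ := h₂.1 fun _ => star (coordMap u x)
  simp only [Finset.univ_unique, Finset.sum_singleton, Matrix.map_apply, Matrix.of_apply] at h₃
  rw [inner_self_eq_norm_sq_to_K, norm_pow, norm_star] at h₃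
  rcases eq_or_ne (coordMap u x) 0 with h₀ | h₀
  · rw [h₀, norm_zero]
    positivity
  have h₄ : 0 < ‖coordMap u x‖ ^ 2 := by positivity
  refine le_of_sq_le_sq ?_ (by positivity)
  refine le_of_mul_le_mul_right ?_ h₄
  refine le_trans (le_of_eq ?_) h₃
  simp
  ring

/-- For a matrix supported in one column, the row part is the weak `ℓ₂` norm of the entries and the
column part a Hilbert–Schmidt sum. -/
theorem sum_norm_sq_coordMap_le (hu : cbNorm u ≤ C) {m : ℕ} (v : Fin m → L2) {M : ℝ}
    (hM : 0 < M) (hr : ∀ z, ∑ i, ‖inner ℂ z (v i)‖ ^ 2 ≤ M ^ 2 * ‖z‖ ^ 2)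
    (hc : ∑ i, ‖A (v i)‖ ^ 2 ≤ M ^ 2) :
    ∑ i, ‖B (coordMap u (v i))‖ ^ 2 ≤ (C * M) ^ 2 := by
  -- The construction needs a column of index `0`, so the empty family is separate.
  rcases m with _ | m
  · simp only [Finset.univ_eq_empty, Finset.sum_empty]
    positivity
  let V : Matrix (Fin (m + 1)) (Fin (m + 1)) L2 := Matrix.of fun i j => if j = 0 then v i else 0
  have h₁ : matNorm (XA A) (matX A V) ≤ M := by
    rw [matNorm_matX_le_iff _ _ hM.le]
    constructor
    · intro p
      have hV : ∀ i, ∑ j, inner ℂ (star (V i j)) (p j) = inner ℂ (star (p 0)) (v i) := fun i => by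
        rw [Finset.sum_eq_single 0 (fun j _ hj => by simp [V, hj]) (by simp), inner_star_comm]
        simp [V]
      simp only [hV]
      refine (hr _).trans ?_
      rw [norm_star]
      gcongr
      exact Finset.single_le_sum (f := fun j => ‖p j‖ ^ 2) (fun _ _ => by positivity)
        (Finset.mem_univ 0)
    · intro q
      have hV : ∀ i, ∑ j, q j • V i j = q 0 • v i := fun i => by
        rw [Finset.sum_eq_single 0 (fun j _ hj => by simp [V, hj]) (by simp)]
        simp [V]
      simp only [hV, map_smul, norm_smul, mul_pow]
      rw [← Finset.mul_sum, mul_comm]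
      gcongr
      exact Finset.single_le_sum (f := fun j => ‖q j‖ ^ 2) (fun _ _ => by positivity)
        (Finset.mem_univ 0)
  have h₂ := matNorm_map_le_of_cbNorm_le hu _ hM h₁
  rw [matX_map, matNorm_matX_le_iff _ _ (by positivity)] at h₂
  simpa [V, Pi.single_apply, apply_ite, ite_pow] using h₂.2 (Pi.single 0 1)

variable {U : XA A ≃ₗ[ℂ] XA B}

/-- Applying `U⁻¹` and then `U` to a unit vector gives `1 ≤ C²`. -/
theorem one_le_of_cbNorm_le (hA : ‖A‖ ≤ 1) (hB : ‖B‖ ≤ 1)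
    (hU : cbNorm (U : XA A →ₗ[ℂ] XA B) ≤ C) (hU' : cbNorm (U.symm : XA B →ₗ[ℂ] XA A) ≤ C) :
    (1 : ℝ) ≤ C := by
  have h₁ := norm_coordMap_le hA hU (coordMap (U.symm : XA B →ₗ[ℂ] XA A) (xi 0))
  have h₂ := norm_coordMap_le hB hU' (xi 0)
  rw [coordMap_comp_symm, norm_xi] at h₁
  rw [norm_xi] at h₂
  nlinarith [C.coe_nonneg]

theorem sum_norm_sq_le_of_orthonormal (hA : ‖A‖ ≤ 1) (hB : ‖B‖ ≤ 1)
    (hU : cbNorm (U : XA A →ₗ[ℂ] XA B) ≤ C) (hU' : cbNorm (U.symm : XA B →ₗ[ℂ] XA A) ≤ C)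
    {m : ℕ} {w : Fin m → L2} (hw : Orthonormal ℂ w) :
    ∑ i, ‖B (w i)‖ ^ 2 ≤
      C ^ 2 * (C ^ 2 + ∑ i, ‖A (coordMap (U.symm : XA B →ₗ[ℂ] XA A) (w i))‖ ^ 2) := by
  have hC := one_le_of_cbNorm_le hA hB hU hU'
  set S := coordMap (U.symm : XA B →ₗ[ℂ] XA A) with hS
  let R : L2 →L[ℂ] L2 := S.mkContinuous C (norm_coordMap_le hB hU')
  have hR : ‖R‖ ≤ C := LinearMap.mkContinuous_norm_le _ C.coe_nonneg _
  have hs : 0 ≤ ∑ i, ‖A (S (w i))‖ ^ 2 := Finset.sum_nonneg fun _ _ => by positivity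
  have hM : (0 : ℝ) < C ^ 2 + ∑ i, ‖A (S (w i))‖ ^ 2 := by positivity
  -- `M² = C² + ∑ ‖A (S (w i))‖²` dominates both parts: Bessel for `w`, applied to the adjoint of
  -- `R`, bounds the row part by `C²`.
  have key := sum_norm_sq_coordMap_le hU (fun i => S (w i)) (Real.sqrt_pos.2 hM) (fun z => ?_) ?_
  · rw [mul_pow, Real.sq_sqrt hM.le] at key
    simpa only [hS, coordMap_comp_symm] using key
  · rw [Real.sq_sqrt hM.le]
    have hz : ∀ i, ‖inner ℂ z (S (w i))‖ = ‖inner ℂ (w i) (R.adjoint z)‖ := fun i => by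
      rw [norm_inner_symm (w i), ContinuousLinearMap.adjoint_inner_left]
      rfl
    simp only [hz]
    refine (hw.sum_inner_products_le (R.adjoint z) (s := Finset.univ)).trans ?_
    calc ‖R.adjoint z‖ ^ 2 ≤ (C * ‖z‖) ^ 2 := by
          gcongr
          refine ContinuousLinearMap.le_of_opNorm_le _ ?_ z
          rwa [LinearIsometryEquiv.norm_map]
      _ ≤ _ := by
          rw [mul_pow]
          gcongr
          linarith
  · rw [Real.sq_sqrt hM.le]
    linarith [sq_nonneg (C : ℝ)]

end CbMaps

/-! ### Diagonal operators and the comparison of `α` with `β`. -/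

section Diagonal

theorem norm_diag_le (α : ℕ → unitInterval) : ‖diag α‖ ≤ 1 :=
  LinearMap.mkContinuous_norm_le _ zero_le_one _

theorem norm_diag_apply (α : ℕ → unitInterval) (x : L2) (i : ℕ) :
    ‖diag α x i‖ = α i * ‖x i‖ := by
  rw [diag_apply, norm_mul, Complex.norm_real, Real.norm_of_nonneg (α i).2.1]

theorem norm_diag_le_of_forall_lt {α : ℕ → unitInterval} (hα : Antitone α) {k : ℕ} {x : L2}
    (hx : ∀ i < k, x i = 0) : ‖diag α x‖ ≤ α k * ‖x‖ := by
  have h : ‖diag α x‖ ≤ ‖((α k : ℝ) : ℂ) • x‖ := by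
    refine lp.norm_mono two_ne_zero fun i => ?_
    rw [norm_diag_apply, lp.coeFn_smul, Pi.smul_apply, norm_smul, Complex.norm_real,
      Real.norm_of_nonneg (α k).2.1]
    rcases lt_or_ge i k with hi | hi
    · simp [hx i hi]
    · gcongr
      exact hα hi
  rwa [norm_smul, Complex.norm_real, Real.norm_of_nonneg (α k).2.1] at h

theorem le_norm_diag_of_forall_gt {α : ℕ → unitInterval} (hα : Antitone α) {k : ℕ} {x : L2}
    (hx : ∀ i > k, x i = 0) : α k * ‖x‖ ≤ ‖diag α x‖ := by
  have h : ‖((α k : ℝ) : ℂ) • x‖ ≤ ‖diag α x‖ := by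
    refine lp.norm_mono two_ne_zero fun i => ?_
    rw [norm_diag_apply, lp.coeFn_smul, Pi.smul_apply, norm_smul, Complex.norm_real,
      Real.norm_of_nonneg (α k).2.1]
    rcases lt_or_ge k i with hi | hi
    · simp [hx i hi]
    · gcongr
      exact hα hi
  rwa [norm_smul, Complex.norm_real, Real.norm_of_nonneg (α k).2.1] at h

theorem orthonormal_xi : Orthonormal ℂ xi := by
  rw [orthonormal_iff_ite]
  intro i j
  rw [inner_xi_left, xi_apply]

/-- The isometric embedding of `ℓ₂ⁿ` onto the span of the first `n` basis vectors of `ℓ₂`. -/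
noncomputable def inclusion (n : ℕ) : EuclideanSpace ℂ (Fin n) →ₗᵢ[ℂ] L2 :=
  LinearMap.isometryOfOrthonormal
    ((EuclideanSpace.basisFun (Fin n) ℂ).toBasis.constr ℂ fun i : Fin n => xi i)
    (v := (EuclideanSpace.basisFun (Fin n) ℂ).toBasis)
    (by simp)
    (by
      convert! orthonormal_xi.comp _ Fin.val_injective using 1
      ext1 i
      simp only [Function.comp_apply, Module.Basis.constr_basis])

theorem inclusion_basisFun {n : ℕ} (i : Fin n) :
    inclusion n (EuclideanSpace.basisFun (Fin n) ℂ i) = xi i := by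
  rw [← OrthonormalBasis.coe_toBasis]
  exact Module.Basis.constr_basis _ _ _ _

theorem isSymmetric_adjoint_comp_self {E : Type*} [NormedAddCommGroup E] [InnerProductSpace ℂ E]
    [CompleteSpace E] (G : E →L[ℂ] L2) : (G.adjoint ∘L G : E →ₗ[ℂ] E).IsSymmetric := fun x y => by
  change inner ℂ (G.adjoint (G x)) y = inner ℂ x (G.adjoint (G y))
  rw [ContinuousLinearMap.adjoint_inner_left, ContinuousLinearMap.adjoint_inner_right]

theorem re_inner_adjoint_comp_self {E : Type*} [NormedAddCommGroup E] [InnerProductSpace ℂ E]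
    [CompleteSpace E] (G : E →L[ℂ] L2) (x : E) :
    (inner ℂ x ((G.adjoint ∘L G : E →ₗ[ℂ] E) x)).re = ‖G x‖ ^ 2 := by
  change (inner ℂ x (G.adjoint (G x))).re = _
  rw [ContinuousLinearMap.adjoint_inner_right, inner_self_eq_norm_sq_to_K]
  norm_cast

variable {α β : ℕ → unitInterval} {C : ℝ≥0}

theorem sum_max_sq_sub_le (hα : Antitone α) (hβ : Antitone β) (U : Xd α ≃ₗ[ℂ] Xd β)
    (hU : cbNorm (U : Xd α →ₗ[ℂ] Xd β) ≤ C) (hU' : cbNorm (U.symm : Xd β →ₗ[ℂ] Xd α) ≤ C)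
    (n : ℕ) :
    ∑ k ∈ Finset.range n, max ((β k : ℝ) ^ 2 - ((C : ℝ) ^ 2 * α k) ^ 2) 0 ≤ ((C : ℝ) ^ 2) ^ 2 := by
  have hn : Module.finrank ℂ (EuclideanSpace ℂ (Fin n)) = n := finrank_euclideanSpace_fin
  let R : L2 →L[ℂ] L2 := (coordMap (U.symm : Xd β →ₗ[ℂ] Xd α)).mkContinuous C
    (norm_coordMap_le (norm_diag_le β) hU')
  have hR : ∀ x, ‖R x‖ ≤ C * ‖x‖ := norm_coordMap_le (norm_diag_le β) hU'
  let J : EuclideanSpace ℂ (Fin n) →L[ℂ] L2 := (inclusion n).toContinuousLinearMap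
  have hJ : ∀ x, ‖J x‖ = ‖x‖ := (inclusion n).norm_map
  let F : EuclideanSpace ℂ (Fin n) →L[ℂ] L2 := diag β ∘L J
  -- The factor `C` puts the constant `C²` of `sum_norm_sq_le_of_orthonormal` inside `G*G`, leaving
  -- `C⁴` as the bound for partial traces.
  let G : EuclideanSpace ℂ (Fin n) →L[ℂ] L2 := ((C : ℝ) : ℂ) • (diag α ∘L R ∘L J)
  have hG : ∀ x, ‖G x‖ = C * ‖diag α (R (J x))‖ := fun x => by
    change ‖((C : ℝ) : ℂ) • diag α (R (J x))‖ = _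
    rw [norm_smul, Complex.norm_real, Real.norm_of_nonneg C.coe_nonneg]
  have hP := isSymmetric_adjoint_comp_self F
  have hQ := isSymmetric_adjoint_comp_self G
  have hβP : ∀ k : Fin n, (β k : ℝ) ^ 2 ≤ hP.eigenvalues hn k := fun k => by
    refine le_eigenvalues_of_subspace hn hP k (Submodule.span ℂ
      (Set.range fun j : {j // j ≤ k} => EuclideanSpace.basisFun (Fin n) ℂ j)) ?_ fun x hx => ?_
    · rw [finrank_span_subfamily, Fintype.card_subtype, Finset.filter_ge_eq_Iic, Fin.card_Iic]
      omega
    · rw [re_inner_adjoint_comp_self, ← mul_pow, ← hJ]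
      have := (β k).2.1
      gcongr
      refine le_norm_diag_of_forall_gt hβ ?_
      induction hx using Submodule.span_induction with
      | mem x h =>
        obtain ⟨⟨j, hj⟩, rfl⟩ := h
        intro i hi
        change inclusion n (EuclideanSpace.basisFun (Fin n) ℂ j) i = 0
        rw [inclusion_basisFun, xi_apply, if_neg]
        have : (j : ℕ) ≤ k := hj
        omega
      | zero => simp
      | add x y _ _ hx hy =>
        intro i hi
        rw [map_add, lp.coeFn_add, Pi.add_apply, hx i hi, hy i hi, add_zero]
      | smul a x _ hx =>
        intro i hi
        rw [map_smul, lp.coeFn_smul, Pi.smul_apply, hx i hi, smul_zero]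
  have hαQ : ∀ k : Fin n, hQ.eigenvalues hn k ≤ ((C : ℝ) ^ 2 * α k) ^ 2 := fun k => by
    -- The kernel of `φ` has codimension at most `k`. On it the first `k` coordinates of `R (J x)`
    -- vanish, so `diag α` contracts by `α k`.
    let φ : EuclideanSpace ℂ (Fin n) →ₗ[ℂ] (Fin k → ℂ) :=
      LinearMap.pi fun i => (innerSL ℂ (xi i)).toLinearMap ∘ₗ (R ∘L J).toLinearMap
    refine eigenvalues_le_of_subspace hn hQ k (LinearMap.ker φ) ?_ fun x hx => ?_
    · have h₁ := φ.finrank_range_add_finrank_ker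
      have h₂ := Submodule.finrank_le (LinearMap.range φ)
      rw [Module.finrank_fin_fun] at h₂
      omega
    · rw [re_inner_adjoint_comp_self, ← mul_pow, hG]
      have hx' : ∀ i < (k : ℕ), R (J x) i = 0 := fun i hi => by
        rw [← inner_xi_left]
        exact congr_fun (LinearMap.mem_ker.1 hx) ⟨i, hi⟩
      have := (α k).2.1
      refine pow_le_pow_left₀ (by positivity) ?_ 2
      calc C * ‖diag α (R (J x))‖ ≤ C * (α k * (C * ‖x‖)) := by
            gcongr
            refine (norm_diag_le_of_forall_lt hα hx').trans ?_
            gcongr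
            exact (hR _).trans_eq (by rw [hJ])
        _ = _ := by ring
  rw [Finset.sum_range]
  refine le_trans (Finset.sum_le_sum fun k _ => ?_)
    (sum_max_eigenvalues_sub_le hn hP hQ fun u s => ?_)
  · exact max_le_max_right _ (sub_le_sub (hβP k) (hαQ k))
  · have hw : Orthonormal ℂ fun i : Fin s.card => J (u (s.equivFin.symm i)) :=
      (u.orthonormal.comp_linearIsometry (inclusion n)).comp
        (fun i : Fin s.card => (s.equivFin.symm i : Fin n))
        (Subtype.val_injective.comp s.equivFin.symm.injective)
    have h := sum_norm_sq_le_of_orthonormal (norm_diag_le α) (norm_diag_le β) hU hU' hw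
    have hs : ∀ f : Fin n → ℝ, ∑ i : Fin s.card, f (s.equivFin.symm i) = ∑ i ∈ s, f i := fun f => by
      rw [Equiv.sum_comp s.equivFin.symm fun i : s => f i, Finset.sum_coe_sort]
    change _ ≤ _ * (_ + ∑ i : Fin s.card, ‖diag α (R (J (u (s.equivFin.symm i))))‖ ^ 2) at h
    rw [hs fun i => ‖diag β (J (u i))‖ ^ 2, hs fun i => ‖diag α (R (J (u i)))‖ ^ 2] at h
    simp only [LinearMap.sub_apply, inner_sub_right, Complex.sub_re, re_inner_adjoint_comp_self,
      hG, Finset.sum_sub_distrib, mul_pow]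
    rw [← Finset.mul_sum]
    change ∑ i ∈ s, ‖diag β (J (u i))‖ ^ 2 - _ ≤ _
    linarith

/-! ### The completely bounded norm of the formal identity. -/

theorem hasSum_norm_sq_diag (α : ℕ → unitInterval) (x : L2) :
    HasSum (fun k => (α k : ℝ) ^ 2 * ‖x k‖ ^ 2) (‖diag α x‖ ^ 2) := by
  have h := lp.hasSum_norm (p := 2) (by norm_num) (diag α x)
  simp only [ENNReal.toReal_ofNat, Real.rpow_ofNat, norm_diag_apply, mul_pow] at h
  exact h

theorem cbNorm_formalId_le {K : ℝ} (hK : 1 ≤ K)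
    (h : ∀ n, ∑ k ∈ Finset.range n, max ((β k : ℝ) ^ 2 - (K * α k) ^ 2) 0 ≤ K ^ 2) :
    cbNorm (formalId α β : Xd α →ₗ[ℂ] Xd β) ≤ ENNReal.ofReal (2 * K) := by
  refine cbNorm_le_of_matNorm_le fun n x hx => ?_
  have hid : coordMap (formalId α β : Xd α →ₗ[ℂ] Xd β) = LinearMap.id := by
    ext1 x
    simp [coordMap, formalId]
  rw [← matX_symm _ x] at hx ⊢
  rw [matX_map, hid]
  generalize x.map (toX (diag α)).symm = V at hx ⊢
  have hV : V.map (LinearMap.id : L2 →ₗ[ℂ] L2) = V := by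
    ext1 i j
    rfl
  rw [hV]
  rw [matNorm_matX_le_iff _ _ zero_le_one, one_pow] at hx
  simp only [one_mul] at hx
  rw [matNorm_matX_le_iff _ _ (by positivity)]
  refine ⟨fun p => (hx.1 p).trans (le_mul_of_one_le_left (by positivity) ?_), fun q => ?_⟩
  · nlinarith
  set y : Fin n → L2 := fun i => ∑ j, q j • V i j with hy
  set s := ∑ j, ‖q j‖ ^ 2 with hs
  have hs₀ : 0 ≤ s := by positivity
  have hcol : ∑ i, ‖diag α (y i)‖ ^ 2 ≤ s := hx.2 q
  -- The row bound tested at `q j • xi k` isolates the `k`-th coordinates of the `y i`.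
  have hrow : ∀ k, ∑ i, ‖y i k‖ ^ 2 ≤ s := fun k => by
    have hp := hx.1 fun j => q j • xi k
    simp only [norm_smul, norm_xi, mul_one] at hp
    refine le_trans (le_of_eq ?_) hp
    refine Finset.sum_congr rfl fun i _ => ?_
    rw [← inner_xi_left, hy]
    simp only
    rw [inner_sum]
    congr 2
    refine Finset.sum_congr rfl fun j _ => ?_
    rw [inner_smul_right, inner_smul_right, inner_star_comm]
    congr 2
    ext m
    simp [xi_apply]
  have hsumβ := hasSum_sum fun i (_ : i ∈ Finset.univ) => hasSum_norm_sq_diag β (y i)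
  have hsumα := hasSum_sum fun i (_ : i ∈ Finset.univ) => hasSum_norm_sq_diag α (y i)
  simp only [← Finset.mul_sum] at hsumβ hsumα
  rw [← hsumβ.tsum_eq]
  refine Real.tsum_le_of_sum_range_le (fun k => by positivity) fun N => ?_
  have hα' := sum_le_hasSum (Finset.range N) (fun k _ => by positivity) hsumα
  calc ∑ k ∈ Finset.range N, (β k : ℝ) ^ 2 * ∑ i, ‖y i k‖ ^ 2
      ≤ ∑ k ∈ Finset.range N, (K ^ 2 * ((α k : ℝ) ^ 2 * ∑ i, ‖y i k‖ ^ 2) +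
          max ((β k : ℝ) ^ 2 - (K * α k) ^ 2) 0 * s) := by
        refine Finset.sum_le_sum fun k _ => ?_
        have h₁ := mul_le_mul_of_nonneg_left (hrow k)
          (le_max_right ((β k : ℝ) ^ 2 - (K * α k) ^ 2) 0)
        have h₂ := mul_le_mul_of_nonneg_right (le_max_left ((β k : ℝ) ^ 2 - (K * α k) ^ 2) 0)
          (show 0 ≤ ∑ i, ‖y i k‖ ^ 2 by positivity)
        linarith
    _ ≤ K ^ 2 * s + K ^ 2 * s := by
        rw [Finset.sum_add_distrib, ← Finset.mul_sum, ← Finset.sum_mul]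
        gcongr
        · exact hα'.trans hcol
        · exact h N
    -- Here `2 K²` is relaxed to `4 K²`; with `K = C²` the resulting `2 C²` is still strictly below
    -- `4 C²`, because `C ≥ 1`.
    _ ≤ (2 * K) ^ 2 * s := by
        nlinarith [mul_nonneg (sq_nonneg K) hs₀]

theorem cbNorm_formalId_lt (hα : Antitone α) (hβ : Antitone β) (U : Xd α ≃ₗ[ℂ] Xd β)
    (hU : cbNorm (U : Xd α →ₗ[ℂ] Xd β) ≤ C) (hU' : cbNorm (U.symm : Xd β →ₗ[ℂ] Xd α) ≤ C) :
    cbNorm (formalId α β : Xd α →ₗ[ℂ] Xd β) < 4 * (C : ℝ≥0∞) ^ 2 := by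
  have hC := one_le_of_cbNorm_le (norm_diag_le α) (norm_diag_le β) hU hU'
  refine (cbNorm_formalId_le (one_le_pow₀ hC) (sum_max_sq_sub_le hα hβ U hU hU')).trans_lt ?_
  have h₄ : 4 * (C : ℝ≥0∞) ^ 2 = ENNReal.ofReal (4 * (C : ℝ) ^ 2) := by
    rw [ENNReal.ofReal_mul (by norm_num), ENNReal.ofReal_pow C.coe_nonneg,
      ENNReal.ofReal_coe_nnreal, ENNReal.ofReal_ofNat]
  rw [h₄, ENNReal.ofReal_lt_ofReal_iff (by positivity)]
  nlinarith

end Diagonal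

end OpSp

open OpSp

theorem mainTheorem3 (α β : ℕ → unitInterval) (hα : α ∈ seqS) (hβ : β ∈ seqS) (C : ℝ≥0)
    (U : Xd α ≃ₗ[ℂ] Xd β)
    (hU : cbNorm (U : Xd α →ₗ[ℂ] Xd β) ≤ C)
    (hU' : cbNorm (U.symm : Xd β →ₗ[ℂ] Xd α) ≤ C) :
    cbNorm (formalId α β : Xd α →ₗ[ℂ] Xd β) < 4 * (C : ℝ≥0∞) ^ 2 ∧
      cbNorm ((formalId α β).symm : Xd β →ₗ[ℂ] Xd α) < 4 * (C : ℝ≥0∞) ^ 2 :=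
  ⟨cbNorm_formalId_lt hα.1 hβ.1 U hU hU', cbNorm_formalId_lt hβ.1 hα.1 U.symm hU' hU⟩
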